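/- Fix $q\in\mathbb N$. For $p\ge 0$, a $p$-current in $\mathbb R^q$ is a continuous linear functional on the smooth compactly supported differential $p$-forms on $\mathbb R^q$; its mass is $M(T)=\sup\{T(\omega): |\omega(x)|\le 1 \text{ for all } x\}\in[0,\infty]$, and the boundary of a $(p+1)$-current $S$ is the $p$-current $\partial S(\omega)=S(d\omega)$. For a $0$-current $H$ and $\lambda\ge 0$, the multiscale flat norm is $$\mathbb F_\lambda(H)=\inf_{S}\big(M(H-\partial S)+\lambda M(S)\big),$$ the infimum being over all $1$-currents $S$ in $\mathbb R^q$. Let $\mathcal I^0$ denote the integral $0$-currents, i.e. the rectifiable $0$-currents $T(\omega)=\int_E m\,\omega\,d\mathcal H^0$ with $E$ a $0$-rectifiable set, $m$ integer valued and $\int_E|m|\,d\mathcal H^0<\infty$. Let $x_1,x_2,x_3\in\mathbb R^q$ with $|x_i-x_j|>4$ for all $i\ne j$, let $T_i\in\mathcal I^0$ be the point mass at $x_i$ with multiplicity $1$ and positive orientation, $T_i(\omega)=\omega(x_i)$, and let $\lambda=1$. Then: 1. The unique median of $T_1,T_2,T_3$ is the trivial current: a $0$-current $T$ minimizes $\sum_{i=1}^3\mathbb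 F_1(T-T_i)$ over $\mathcal I^0$ if and only if $T=0$. 2. For every $\mu\ge 0$, the unique mass-regularized median is also the trivial current: a $0$-current $T$ minimizes $\sum_{i=1}^3\mathbb F_1(T-T_i)+\mu M(T)$ over $\mathcal I^0$ if and only if $T=0$. -/

import Mathlib

open MeasureTheory Filter Topology TopologicalSpace
open scoped NNReal ENNReal Distributions

noncomputable section

namespace MedianShape

/-- The ambient Euclidean space `ℝ^q`. -/
abbrev Space (q : ℕ) : Type := EuclideanSpace ℝ (Fin q)

/-- The normed space of `p`-covectors on `ℝ^q`. Its operator norm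
`sup { |α(v₁,…,v_p)| : ‖v_i‖ ≤ 1 }` is the comass norm: by Hadamard's inequality the supremum
may be restricted to orthonormal `v₁,…,v_p`. -/
abbrev Covector (q p : ℕ) : Type := Space q [⋀^Fin p]→L[ℝ] ℝ

/-- Smooth compactly supported differential `p`-forms on `ℝ^q`, with the usual (LF) topology of
test functions. -/
abbrev Form (q p : ℕ) : Type := 𝓓((⊤ : Opens (Space q)), Covector q p)

/-- `p`-dimensional currents in `ℝ^q`: continuous linear functionals on `p`-forms. -/
abbrev Current (q p : ℕ) : Type := Form q p →L[ℝ] ℝ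

/-- The exterior derivative as a continuous linear map on compactly supported forms. -/
def extDerivForm (q p : ℕ) : Form q p →L[ℝ] Form q (p + 1) :=
  TestFunction.postcompCLM
      (ContinuousAlternatingMap.alternatizeUncurryFinCLM ℝ (Space q) ℝ (n := p)) ∘L
    TestFunction.fderivCLM ℝ ⊤ ⊤

theorem extDerivForm_apply {q p : ℕ} (ω : Form q p) (x : Space q) :
    extDerivForm q p ω x = extDeriv (ω : Space q → Covector q p) x := by
  simp [extDerivForm, extDeriv]

/-- The boundary `∂T(ω) = T(dω)`. -/
def boundary {q p : ℕ} (T : Current q (p + 1)) : Current q p :=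
  T ∘L extDerivForm q p

/-- The mass `M(T) = sup { T(ω) : |ω| ≤ 1 }`, with values in `[0, ∞]`. -/
def mass {q p : ℕ} (T : Current q p) : ℝ≥0∞ :=
  ⨆ (ω : Form q p) (_ : ∀ x, ‖ω x‖ ≤ 1), ENNReal.ofReal (T ω)

/-- `E ⊆ ⋃ f_i(ℝ^p) ∪ N₀` with Lipschitz `f_i` and `ℋ^p(N₀) = 0`. Here `μHE[p]` is the
`p`-dimensional Hausdorff measure with its Euclidean normalization. -/
def IsRectifiableSet {q : ℕ} (p : ℕ) (E : Set (Space q)) : Prop :=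
  ∃ (f : ℕ → Space p → Space q) (N₀ : Set (Space q)),
    (∀ i, ∃ K : ℝ≥0, LipschitzWith K (f i)) ∧ μHE[p] N₀ = 0 ∧
      E ⊆ (⋃ i, Set.range (f i)) ∪ N₀

/-- `P` is the approximate tangent space at `x` of the `p`-dimensional set `E` with
multiplicity `m`: the blow-ups at `x` of the measure `|m| ℋ^p ⌞ E` converge weakly to
`|m(x)| ℋ^p ⌞ P`. -/
def IsApproxTangent {q : ℕ} (p : ℕ) (E : Set (Space q)) (m : Space q → ℤ) (x : Space q)
    (P : Submodule ℝ (Space q)) : Prop :=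
  ∀ φ : Space q → ℝ, Continuous φ → HasCompactSupport φ →
    Tendsto (fun r : ℝ => (r ^ p)⁻¹ * ∫ y in E, φ (r⁻¹ • (y - x)) * |(m y : ℝ)| ∂μHE[p])
      (𝓝[>] 0) (𝓝 (|(m x : ℝ)| * ∫ y in (P : Set (Space q)), φ y ∂μHE[p]))

/-- Rectifiable `p`-currents: `T(ω) = ∫_E m(x) ω(ζ(x)) dℋ^p`, where `E` is `p`-rectifiable, `m` is
integer valued and `ℋ^p`-integrable on `E`, and `ζ(x) = τ₁(x) ∧ … ∧ τ_p(x)` is a measurable unit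
simple `p`-vector which spans the approximate tangent space. (For `p = 0` the frame `τ` is empty,
and the orientation `±1` of a point is the sign of `m`.) -/
def IsRectifiable {q p : ℕ} (T : Current q p) : Prop :=
  ∃ (E : Set (Space q)) (m : Space q → ℤ) (τ : Space q → Fin p → Space q),
    MeasurableSet E ∧ IsRectifiableSet p E ∧
    Integrable (fun x => (m x : ℝ)) (μHE[p].restrict E) ∧
    AEMeasurable τ (μHE[p].restrict E) ∧
    (∀ᵐ x ∂(μHE[p].restrict E), m x ≠ 0 →
      Orthonormal ℝ (τ x) ∧ IsApproxTangent p E m x (Submodule.span ℝ (Set.range (τ x)))) ∧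
    ∀ ω : Form q p, T ω = ∫ x in E, (m x : ℝ) * ω x (τ x) ∂μHE[p]

/-- Integral currents: `T` and `∂T` are rectifiable (the boundary of a `0`-current being zero,
the second condition is empty for `p = 0`). -/
def IsIntegral {q : ℕ} : {p : ℕ} → Current q p → Prop
  | 0, T => IsRectifiable T
  | _ + 1, T => IsRectifiable T ∧ IsRectifiable (boundary T)

/-- The multiscale flat norm
`𝔽_λ(H) = inf { M(H - ∂S) + λ M(S) : S a (p+1)-current }`. -/
def flatNorm {q p : ℕ} (lam : ℝ≥0) (H : Current q p) : ℝ≥0∞ :=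
  ⨅ S : Current q (p + 1), mass (H - boundary S) + lam * mass S

/-- The objective `∑ᵢ 𝔽_λ(T - Tᵢ) + μ M(T)`. -/
def objective {q p N : ℕ} (lam mu : ℝ≥0) (Ts : Fin N → Current q p) (T : Current q p) : ℝ≥0∞ :=
  ∑ i, flatNorm lam (T - Ts i) + mu * mass T

/-- `T` is a mass-regularized median of `T₁,…,T_N`: it minimizes `∑ᵢ 𝔽_λ(T - Tᵢ) + μ M(T)` among
integral currents. -/
def IsRegularizedMedian {q p N : ℕ} (lam mu : ℝ≥0) (Ts : Fin N → Current q p)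
    (T : Current q p) : Prop :=
  IsIntegral T ∧ ∀ T' : Current q p, IsIntegral T' → objective lam mu Ts T ≤ objective lam mu Ts T'

/-- `T` is a median of `T₁,…,T_N`: it minimizes `∑ᵢ 𝔽_λ(T - Tᵢ)` among integral currents. -/
def IsMedian {q p N : ℕ} (lam : ℝ≥0) (Ts : Fin N → Current q p) (T : Current q p) : Prop :=
  IsIntegral T ∧ ∀ T' : Current q p, IsIntegral T' →
    ∑ i, flatNorm lam (T - Ts i) ≤ ∑ i, flatNorm lam (T' - Ts i)

/-- The `0`-current given by the point `a` with multiplicity `1` and positive orientation: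
a `0`-form, that is a function, is evaluated at `a`. -/
def pointMass {q : ℕ} (a : Space q) : Current q 0 :=
  ContinuousAlternatingMap.apply ℝ (Space q) ℝ ![] ∘L BoundedContinuousFunction.evalCLM ℝ a ∘L
    TestFunction.toBoundedContinuousFunctionCLM ℝ

theorem pointMass_apply {q : ℕ} (a : Space q) (ω : Form q 0) : pointMass a ω = ω a ![] :=
  rfl

end MedianShape

end

/-! A `0`-form `f` with `|f| ≤ 1` and `|df| ≤ 1` calibrates: `H(f) ≤ 𝔽₁(H)`. If also `f(a) = 1` and
`f(b) = -1`, testing `T - δ_a` on `-f` and `T - δ_b` on `f` cancels `T`, so the two flat norms add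
up to at least `2` (`flatNorm_pair_ge`). Averaging over the three pairs bounds the sum below by `3`,
which `T = 0` attains since a point has mass at most `1`.

If `T` attains `3`, removing any pair leaves each term at most `1`, which forces `T(f) = 0` for
every such `f`. As the distance exceeds `4`, `f` can be chosen with slack: `|f| < 1` off `{a, b}`
and `|df| ≤ c < 1`. Then `f + εg` is again admissible for `g` supported off `{a, b}`, hence `T(g) =
0`. So `T` is supported in each of the three pairs; they have no common point, and `T = 0`. The term
`μ M(T)` is nonnegative and vanishes at `0`. -/

namespace MedianShape

open scoped ContDiff

/-! ### Smooth functions separating two distant points -/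

section Separating

theorem stereoHeight_denom_pos {E : Type*} [NormedAddCommGroup E] {a : E} (ha : a ≠ 0) (y : E) :
    0 < ‖y‖ ^ 2 + ‖a‖ ^ 2 := by
  have := norm_pos_iff.2 ha
  positivity

variable {E : Type*} [NormedAddCommGroup E] [InnerProductSpace ℝ E]

/-- The ratio `2⟨y, a⟩ / (‖y‖² + ‖a‖²)`, a height function of the inverse stereographic projection;
it equals `1` at `a` and `-1` at `-a`. -/
noncomputable def stereoHeight (a y : E) : ℝ :=
  2 * inner ℝ y a / (‖y‖ ^ 2 + ‖a‖ ^ 2)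

theorem contDiff_stereoHeight {a : E} (ha : a ≠ 0) {n : WithTop ℕ∞} :
    ContDiff ℝ n (stereoHeight a) := by
  refine ContDiff.div ?_ ?_ fun y => (stereoHeight_denom_pos ha y).ne'
  · exact contDiff_const.mul (contDiff_id.inner ℝ contDiff_const)
  · exact (contDiff_norm_sq ℝ).add contDiff_const

theorem stereoHeight_self {a : E} (ha : a ≠ 0) : stereoHeight a a = 1 := by
  have := norm_pos_iff.2 ha
  rw [stereoHeight, real_inner_self_eq_norm_sq]
  field_simp
  ring

theorem stereoHeight_neg_self {a : E} (ha : a ≠ 0) : stereoHeight a (-a) = -1 := by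
  have := norm_pos_iff.2 ha
  rw [stereoHeight, inner_neg_left, real_inner_self_eq_norm_sq, norm_neg]
  field_simp
  ring

/-- The denominator minus or plus the numerator is `‖y ∓ a‖²`. -/
theorem abs_stereoHeight_lt_one {a y : E} (ha : a ≠ 0) (h₁ : y ≠ a) (h₂ : y ≠ -a) :
    |stereoHeight a y| < 1 := by
  have hD := stereoHeight_denom_pos ha y
  have hm : 0 < ‖y - a‖ ^ 2 := by
    have := norm_pos_iff.2 (sub_ne_zero.2 h₁)
    positivity
  have hp : 0 < ‖y + a‖ ^ 2 := by
    have : y + a ≠ 0 := fun h => h₂ (eq_neg_of_add_eq_zero_left h)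
    have := norm_pos_iff.2 this
    positivity
  rw [norm_sub_sq_real] at hm
  rw [norm_add_sq_real] at hp
  rw [stereoHeight, abs_lt, lt_div_iff₀ hD, div_lt_iff₀ hD]
  constructor <;> linarith

theorem abs_stereoHeight_le_one {a : E} (ha : a ≠ 0) (y : E) : |stereoHeight a y| ≤ 1 := by
  by_cases h₁ : y = a
  · simp [h₁, stereoHeight_self ha]
  by_cases h₂ : y = -a
  · simp [h₂, stereoHeight_neg_self ha]
  exact (abs_stereoHeight_lt_one ha h₁ h₂).le

theorem fderiv_stereoHeight {a : E} (ha : a ≠ 0) (y v : E) :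
    fderiv ℝ (stereoHeight a) y v =
      inner ℝ ((2 / (‖y‖ ^ 2 + ‖a‖ ^ 2)) • a -
        (4 * inner ℝ y a / (‖y‖ ^ 2 + ‖a‖ ^ 2) ^ 2) • y) v := by
  have hD := stereoHeight_denom_pos ha y
  have h₁ : HasFDerivAt (fun y : E => 2 * inner ℝ y a) ((2 : ℝ) • innerSL ℝ a) y := by
    have := (innerSL ℝ a).hasFDerivAt (x := y) |>.const_mul 2
    refine this.congr_of_eventuallyEq (Eventually.of_forall fun z => ?_)
    simp [real_inner_comm]
  have h₂ : HasFDerivAt (fun y : E => ‖y‖ ^ 2 + ‖a‖ ^ 2) (2 • innerSL ℝ y) y :=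
    (hasStrictFDerivAt_norm_sq y).hasFDerivAt.add_const _
  have h : HasFDerivAt (stereoHeight a) _ y :=
    h₁.mul ((hasDerivAt_inv hD.ne').comp_hasFDerivAt y h₂)
  rw [h.fderiv]
  simp only [add_apply, smul_apply, innerSL_apply_apply,
    inner_sub_left, real_inner_smul_left, smul_eq_mul, nsmul_eq_mul]
  field_simp
  push_cast
  ring

/-- With `D = ‖y‖² + ‖a‖²` and `s = ⟨y, a⟩`, the squared length of the gradient is `(2‖a‖/D)² -
(4s‖a‖/D²)²`, and `D ≥ ‖a‖²`. -/
theorem norm_fderiv_stereoHeight_le {a : E} (ha : a ≠ 0) (y : E) :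
    ‖fderiv ℝ (stereoHeight a) y‖ ≤ 2 / ‖a‖ := by
  have hD := stereoHeight_denom_pos ha y
  have ha' := norm_pos_iff.2 ha
  refine ContinuousLinearMap.opNorm_le_bound _ (by positivity) fun v => ?_
  rw [fderiv_stereoHeight ha]
  refine (norm_inner_le_norm _ _).trans (mul_le_mul_of_nonneg_right ?_ (norm_nonneg v))
  refine abs_le_of_sq_le_sq' ?_ (by positivity) |>.2
  rw [norm_sub_sq_real, norm_smul, norm_smul, real_inner_smul_left, real_inner_smul_right,
    real_inner_comm y a, mul_pow, mul_pow, Real.norm_eq_abs, Real.norm_eq_abs, sq_abs, sq_abs]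
  set D := ‖y‖ ^ 2 + ‖a‖ ^ 2 with hDdef
  set s := inner ℝ y a
  have key : (2 / D) ^ 2 * ‖a‖ ^ 2 - 2 * (2 / D * (4 * s / D ^ 2 * s)) +
      (4 * s / D ^ 2) ^ 2 * ‖y‖ ^ 2 = (2 * ‖a‖ / D) ^ 2 - (4 * s * ‖a‖ / D ^ 2) ^ 2 := by
    have : ‖y‖ ^ 2 = D - ‖a‖ ^ 2 := by rw [hDdef]; ring
    rw [this]
    field_simp
    ring
  have le : 2 * ‖a‖ / D ≤ 2 / ‖a‖ := by
    rw [div_le_div_iff₀ hD ha', hDdef]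
    nlinarith [sq_nonneg ‖y‖]
  calc _ = (2 * ‖a‖ / D) ^ 2 - (4 * s * ‖a‖ / D ^ 2) ^ 2 := by rw [← key]
    _ ≤ (2 * ‖a‖ / D) ^ 2 := by linarith [sq_nonneg (4 * s * ‖a‖ / D ^ 2)]
    _ ≤ (2 / ‖a‖) ^ 2 := by gcongr

variable [FiniteDimensional ℝ E]

/-- Smooth cutoff functions with arbitrarily small gradient. -/
theorem exists_flat_cutoff (r : ℝ) {ε : ℝ} (hε : 0 < ε) :
    ∃ χ : E → ℝ, ContDiff ℝ ∞ χ ∧ HasCompactSupport χ ∧ (∀ y, ‖y‖ ≤ r → χ y = 1) ∧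
      (∀ y, |χ y| ≤ 1) ∧ ∀ y, ‖fderiv ℝ χ y‖ ≤ ε := by
  let β : ContDiffBump (0 : E) := ⟨1, 2, one_pos, one_lt_two⟩
  have hβ : ContDiff ℝ ∞ (β : E → ℝ) := β.contDiff
  obtain ⟨C, hC⟩ := (hβ.continuous_fderiv (by simp)).bounded_above_of_compact_support
    (β.hasCompactSupport.fderiv ℝ)
  -- Dilation factor: `R ≥ r` puts the `r`-ball inside the plateau, `R ≥ C / ε` makes the gradient
  -- small.
  set R : ℝ := max (max r 1) (C / ε)
  have hR : 0 < R := lt_of_lt_of_le one_pos ((le_max_right r 1).trans (le_max_left _ _))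
  refine ⟨fun y => β (R⁻¹ • y), hβ.comp (contDiff_id.const_smul _), ?_, ?_, ?_, ?_⟩
  · exact β.hasCompactSupport.comp_homeomorph (Homeomorph.smulOfNeZero R⁻¹ (inv_ne_zero hR.ne'))
  · intro y hy
    refine β.one_of_mem_closedBall ?_
    rw [mem_closedBall_zero_iff, norm_smul, norm_inv, Real.norm_of_nonneg hR.le,
      inv_mul_le_iff₀ hR]
    change ‖y‖ ≤ R * 1
    rw [mul_one]
    exact hy.trans ((le_max_left r 1).trans (le_max_left _ _))
  · intro y
    rw [abs_of_nonneg β.nonneg]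
    exact β.le_one
  · intro y
    have e : fderiv ℝ (fun y => β (R⁻¹ • y)) y = R⁻¹ • fderiv ℝ β (R⁻¹ • y) :=
      fderiv_comp_smul (f := β) R⁻¹
    rw [e, norm_smul, norm_inv, Real.norm_of_nonneg hR.le, inv_mul_le_iff₀ hR]
    calc _ ≤ C := hC _
      _ ≤ R * ε := (div_le_iff₀ hε).1 (le_max_right _ _)

/-- With the midpoint as origin the points are `±v`, `‖v‖ > 2`, and `stereoHeight v` has slope at
most `2 / ‖v‖ < 1`. A flat cutoff makes the support compact. -/
theorem exists_separating_function {a b : E} (h : 4 < dist a b) :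
    ∃ f : E → ℝ, ContDiff ℝ ∞ f ∧ HasCompactSupport f ∧ f a = 1 ∧ f b = -1 ∧
      (∀ y, y ≠ a → y ≠ b → |f y| < 1) ∧ ∃ c < 1, ∀ y, ‖fderiv ℝ f y‖ ≤ c := by
  set v : E := (2 : ℝ)⁻¹ • (a - b) with hv
  set m : E := (2 : ℝ)⁻¹ • (a + b) with hm
  have ham : a - m = v := by rw [hv, hm]; module
  have hbm : b - m = -v := by rw [hv, hm]; module
  have hv2 : 2 < ‖v‖ := by
    rw [hv, norm_smul, ← dist_eq_norm]
    norm_num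
    linarith
  have hv0 : v ≠ 0 := norm_pos_iff.1 (by linarith)
  have h1 : 2 / ‖v‖ < 1 := (div_lt_one (by linarith)).2 hv2
  -- The cutoff spends only half of the slack `1 - 2 / ‖v‖` in the gradient, so the total stays
  -- below `1`.
  obtain ⟨χ, hχ, hχc, hχ1, hχle, hχd⟩ :=
    exists_flat_cutoff (E := E) ‖v‖ (half_pos (sub_pos.2 h1))
  set g : E → ℝ := fun y => χ y * stereoHeight v y with hg
  have hgs : ContDiff ℝ ∞ g := hχ.mul (contDiff_stereoHeight hv0)
  refine ⟨fun y => g (y - m), hgs.comp (contDiff_id.sub contDiff_const), ?_, ?_, ?_, ?_,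
    (1 - 2 / ‖v‖) / 2 + 2 / ‖v‖, by linarith, ?_⟩
  · exact (hχc.mul_right (f' := stereoHeight v)).comp_homeomorph (Homeomorph.subRight m)
  · simp only [ham, hg, hχ1 v le_rfl, stereoHeight_self hv0, mul_one]
  · simp only [hbm, hg, hχ1 (-v) (norm_neg v).le, stereoHeight_neg_self hv0, one_mul]
  · intro y hya hyb
    have := abs_stereoHeight_lt_one (a := v) (y := y - m) hv0
      (fun e => hya (sub_left_injective (e.trans ham.symm)))
      (fun e => hyb (sub_left_injective (e.trans hbm.symm)))
    rw [hg]
    simp only [abs_mul]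
    calc _ ≤ 1 * |stereoHeight v (y - m)| := by gcongr; exact hχle _
      _ < 1 := by rwa [one_mul]
  · intro y
    have e : fderiv ℝ (fun y => g (y - m)) y = fderiv ℝ g (y - m) := fderiv_comp_sub m
    rw [e]
    set z := y - m
    have e' : fderiv ℝ g z = χ z • fderiv ℝ (stereoHeight v) z + stereoHeight v z • fderiv ℝ χ z :=
      fderiv_fun_mul (hχ.differentiable (by simp) z)
        ((contDiff_stereoHeight hv0 (n := 1)).differentiable (by simp) z)
    rw [e', add_comm ((1 - 2 / ‖v‖) / 2)]
    refine (norm_add_le _ _).trans (add_le_add ?_ ?_)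
    · rw [norm_smul, Real.norm_eq_abs]
      exact (mul_le_of_le_one_left (norm_nonneg _) (hχle z)).trans
        (norm_fderiv_stereoHeight_le hv0 z)
    · rw [norm_smul, Real.norm_eq_abs]
      exact (mul_le_of_le_one_left (norm_nonneg _) (abs_stereoHeight_le_one hv0 z)).trans (hχd z)

end Separating

/-! ### Calibration of the flat norm by `0`-forms -/

section Currents

variable {q : ℕ}

/-- The `0`-form given by a smooth compactly supported function. -/
noncomputable def zeroForm (f : Space q → ℝ) (hf : ContDiff ℝ ∞ f) (hc : HasCompactSupport f) :
    Form q 0 where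
  toFun y := ContinuousAlternatingMap.constOfIsEmpty ℝ (Space q) (Fin 0) (f y)
  contDiff' :=
    (ContinuousAlternatingMap.constOfIsEmptyLIE ℝ (Space q) ℝ (Fin 0)).contDiff.comp hf
  hasCompactSupport' := hc.comp_left (g := ContinuousAlternatingMap.constOfIsEmpty ℝ _ _)
    (ContinuousAlternatingMap.constOfIsEmptyLIE ℝ (Space q) ℝ (Fin 0)).map_zero
  tsupport_subset' := Set.subset_univ _

theorem zeroForm_apply (f : Space q → ℝ) (hf : ContDiff ℝ ∞ f) (hc : HasCompactSupport f)
    (y : Space q) (v : Fin 0 → Space q) : zeroForm f hf hc y v = f y :=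
  rfl

theorem norm_zeroForm (f : Space q → ℝ) (hf : ContDiff ℝ ∞ f) (hc : HasCompactSupport f)
    (y : Space q) : ‖zeroForm f hf hc y‖ = |f y| :=
  ContinuousAlternatingMap.norm_constOfIsEmpty ..

theorem norm_zeroForm_deriv_le (f : Space q → ℝ) (hf : ContDiff ℝ ∞ f) (hc : HasCompactSupport f)
    (y : Space q) : ‖extDerivForm q 0 (zeroForm f hf hc) y‖ ≤ ‖fderiv ℝ f y‖ := by
  have e : extDerivForm q 0 (zeroForm f hf hc) y =
      .ofSubsingleton _ _ _ (0 : Fin 1) (fderiv ℝ f y) :=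
    (extDerivForm_apply _ _).trans (extDeriv_constOfIsEmpty f y)
  rw [e]
  refine ContinuousAlternatingMap.opNorm_le_bound _ (norm_nonneg _) fun v => ?_
  simpa using (fderiv ℝ f y).le_opNorm (v 0)

/-- A `0`-form as a function. -/
noncomputable def Form.toScalar (η : Form q 0) : Space q → ℝ := fun y => η y ![]

theorem Form.contDiff_toScalar (η : Form q 0) : ContDiff ℝ ∞ η.toScalar :=
  (ContinuousAlternatingMap.apply ℝ (Space q) ℝ ![]).contDiff.comp η.contDiff

theorem Form.hasCompactSupport_toScalar (η : Form q 0) : HasCompactSupport η.toScalar :=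
  η.hasCompactSupport.comp_left (g := ContinuousAlternatingMap.apply ℝ (Space q) ℝ ![]) (map_zero _)

theorem Form.zeroForm_toScalar (η : Form q 0) :
    zeroForm η.toScalar η.contDiff_toScalar η.hasCompactSupport_toScalar = η := by
  ext y v
  rw [zeroForm_apply, Form.toScalar, Subsingleton.elim ![] v]

theorem ofReal_apply_le_mass {p : ℕ} (T : Current q p) {η : Form q p} (h : ∀ x, ‖η x‖ ≤ 1) :
    ENNReal.ofReal (T η) ≤ mass T :=
  le_iSup₂_of_le η h le_rfl

theorem mass_zero {p : ℕ} : mass (0 : Current q p) = 0 := by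
  simp [mass]

/-- Forms whose comass and whose differential's comass are at most `1` calibrate `𝔽₁`. -/
theorem ofReal_apply_le_flatNorm {p : ℕ} (H : Current q p) {η : Form q p} (h₀ : ∀ x, ‖η x‖ ≤ 1)
    (h₁ : ∀ x, ‖extDerivForm q p η x‖ ≤ 1) : ENNReal.ofReal (H η) ≤ flatNorm 1 H := by
  refine le_iInf fun S => ?_
  have e : H η = (H - boundary S) η + S (extDerivForm q p η) := by simp [boundary]
  rw [e, ENNReal.coe_one, one_mul]
  exact ENNReal.ofReal_add_le.trans
    (add_le_add (ofReal_apply_le_mass _ h₀) (ofReal_apply_le_mass _ h₁))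

theorem flatNorm_le_mass {p : ℕ} (lam : ℝ≥0) (H : Current q p) : flatNorm lam H ≤ mass H := by
  refine iInf_le_of_le 0 ?_
  simp [boundary, mass_zero]

theorem mass_neg_pointMass_le (a : Space q) : mass (-pointMass a) ≤ 1 := by
  refine iSup₂_le fun η hη => ?_
  rw [← ENNReal.ofReal_one]
  refine ENNReal.ofReal_le_ofReal ?_
  have h := (η a).le_opNorm ![]
  rw [Finset.univ_eq_empty, Finset.prod_empty, mul_one] at h
  exact (neg_le_abs _).trans (h.trans (hη a))

theorem isIntegral_zero : IsIntegral (0 : Current q 0) := by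
  refine ⟨∅, 0, 0, MeasurableSet.empty, ⟨fun _ _ => 0, ∅, fun _ => ⟨0, LipschitzWith.const _⟩,
    measure_empty, Set.empty_subset _⟩, ?_, ?_, ?_, ?_⟩ <;> simp

theorem flatNorm_pair_ge {a b : Space q} (h : 4 < dist a b) (T : Current q 0) :
    2 ≤ flatNorm 1 (T - pointMass a) + flatNorm 1 (T - pointMass b) := by
  obtain ⟨f, hf, hc, hfa, hfb, hf1, c, hc1, hfc⟩ := exists_separating_function h
  have hle : ∀ y, ‖zeroForm f hf hc y‖ ≤ 1 := fun y => by
    rw [norm_zeroForm]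
    by_cases ha : y = a
    · simp [ha, hfa]
    by_cases hb : y = b
    · simp [hb, hfb]
    exact (hf1 y ha hb).le
  have hde : ∀ y, ‖extDerivForm q 0 (zeroForm f hf hc) y‖ ≤ 1 := fun y =>
    (norm_zeroForm_deriv_le ..).trans ((hfc y).trans hc1.le)
  have h₁ := ofReal_apply_le_flatNorm (T - pointMass a) (η := -zeroForm f hf hc)
    (fun y => by simpa using hle y) (fun y => by simpa using hde y)
  have h₂ := ofReal_apply_le_flatNorm (T - pointMass b) hle hde
  refine le_trans ?_ (ENNReal.ofReal_add_le.trans (add_le_add h₁ h₂))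
  have e : (T - pointMass a) (-zeroForm f hf hc) + (T - pointMass b) (zeroForm f hf hc) = 2 := by
    simp only [sub_apply, map_neg, pointMass_apply, zeroForm_apply, hfa, hfb]
    ring
  rw [e]
  simp

/-- If `T` has flat distance at most `1` from the point masses at `a` and `b`, then every calibrating
`0`-form that separates `a` from `b` vanishes on `T`. -/
theorem apply_eq_zero_of_separating {a b : Space q} {T : Current q 0}
    (ha : flatNorm 1 (T - pointMass a) ≤ 1) (hb : flatNorm 1 (T - pointMass b) ≤ 1)
    {f : Space q → ℝ} (hf : ContDiff ℝ ∞ f) (hc : HasCompactSupport f) (hfa : f a = 1)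
    (hfb : f b = -1) (h₀ : ∀ y, |f y| ≤ 1) (h₁ : ∀ y, ‖fderiv ℝ f y‖ ≤ 1) :
    T (zeroForm f hf hc) = 0 := by
  have hle : ∀ y, ‖zeroForm f hf hc y‖ ≤ 1 := fun y => by rw [norm_zeroForm]; exact h₀ y
  have hde : ∀ y, ‖extDerivForm q 0 (zeroForm f hf hc) y‖ ≤ 1 := fun y =>
    (norm_zeroForm_deriv_le ..).trans (h₁ y)
  have h₁ := (ofReal_apply_le_flatNorm (T - pointMass a) (η := -zeroForm f hf hc)
    (fun y => by simpa using hle y) (fun y => by simpa using hde y)).trans ha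
  have h₂ := (ofReal_apply_le_flatNorm (T - pointMass b) hle hde).trans hb
  rw [ENNReal.ofReal_le_one] at h₁ h₂
  simp only [sub_apply, map_neg, pointMass_apply, zeroForm_apply, hfa, hfb]
    at h₁ h₂
  linarith

/-- Both `f` and the perturbation `f + εg` are separating calibrations, so `T` kills their
difference `εg`. -/
theorem apply_eq_zero_of_notMem_tsupport {a b : Space q} (h : 4 < dist a b) {T : Current q 0}
    (ha : flatNorm 1 (T - pointMass a) ≤ 1) (hb : flatNorm 1 (T - pointMass b) ≤ 1)
    {g : Space q → ℝ} (hg : ContDiff ℝ ∞ g) (hgc : HasCompactSupport g) (hga : a ∉ tsupport g)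
    (hgb : b ∉ tsupport g) : T (zeroForm g hg hgc) = 0 := by
  obtain ⟨f, hf, hc, hfa, hfb, hf1, c, hc1, hfc⟩ := exists_separating_function h
  have hle : ∀ y, |f y| ≤ 1 := fun y => by
    by_cases ha : y = a
    · simp [ha, hfa]
    by_cases hb : y = b
    · simp [hb, hfb]
    exact (hf1 y ha hb).le
  -- Compactness turns `|f| < 1` off `{a, b}` into a uniform gap on the support of `g`.
  obtain ⟨δ, hδ1, hδ⟩ : ∃ δ < 1, ∀ y ∈ tsupport g, |f y| ≤ δ := by
    rcases (tsupport g).eq_empty_or_nonempty with he | hne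
    · exact ⟨0, one_pos, by simp [he]⟩
    · obtain ⟨z, hz, hmax⟩ := hgc.isCompact.exists_isMaxOn hne hf.continuous.abs.continuousOn
      exact ⟨|f z|, hf1 z (fun e => hga (e ▸ hz)) (fun e => hgb (e ▸ hz)), fun y hy => hmax hy⟩
  obtain ⟨C, hC⟩ := hg.continuous.bounded_above_of_compact_support hgc
  obtain ⟨D, hD⟩ := (hg.continuous_fderiv (by simp)).bounded_above_of_compact_support
    (hgc.fderiv ℝ)
  have hC0 : 0 ≤ C := (norm_nonneg _).trans (hC 0)
  have hD0 : 0 ≤ D := (norm_nonneg _).trans (hD 0)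
  -- Small enough to fit the slack in both value and gradient; the `+ 1` keeps the denominators
  -- positive.
  set ε : ℝ := min ((1 - δ) / (C + 1)) ((1 - c) / (D + 1))
  have hε : 0 < ε := lt_min (div_pos (by linarith) (by linarith))
    (div_pos (by linarith) (by linarith))
  have hεC : ε * C ≤ 1 - δ := by
    have : ε * (C + 1) ≤ 1 - δ := (le_div_iff₀ (by linarith)).1 (min_le_left _ _)
    linarith
  have hεD : ε * D ≤ 1 - c := by
    have : ε * (D + 1) ≤ 1 - c := (le_div_iff₀ (by linarith)).1 (min_le_right _ _)
    linarith
  have hs : ContDiff ℝ ∞ (ε • g) := hg.const_smul ε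
  have h₁ := apply_eq_zero_of_separating ha hb hf hc hfa hfb hle fun y => (hfc y).trans hc1.le
  have h₂ := apply_eq_zero_of_separating ha hb (hf.add hs)
    (hc.add (hgc.smul_left (f := fun _ => ε)))
    (by simp [hfa, image_eq_zero_of_notMem_tsupport hga])
    (by simp [hfb, image_eq_zero_of_notMem_tsupport hgb])
    (fun y => by
      by_cases hy : y ∈ tsupport g
      · have : |ε * g y| ≤ ε * C := by
          rw [abs_mul, abs_of_pos hε]
          exact mul_le_mul_of_nonneg_left (hC y) hε.le
        exact (abs_add_le _ _).trans (by simpa using (by linarith [hδ y hy] : |f y| + |ε * g y| ≤ 1))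
      · simpa [image_eq_zero_of_notMem_tsupport hy] using hle y)
    (fun y => by
      rw [fderiv_fun_add (hf.differentiable (by simp) y) (hs.differentiable (by simp) y),
        fderiv_const_smul (hg.differentiable (by simp) y)]
      refine (norm_add_le _ _).trans ?_
      rw [norm_smul, Real.norm_of_nonneg hε.le]
      have := mul_le_mul_of_nonneg_left (hD y) hε.le
      linarith [hfc y])
  have e : zeroForm (fun y => f y + (ε • g) y) (hf.add hs)
      (hc.add (hgc.smul_left (f := fun _ => ε))) =
      zeroForm f hf hc + ε • zeroForm g hg hgc := by
    ext y v
    rfl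
  rw [e, map_add, h₁, zero_add, map_smul, smul_eq_mul] at h₂
  exact (mul_eq_zero.1 h₂).resolve_left hε.ne'

/-- The zero current is the only `0`-current with flat distance at most `1` from three point masses
at mutual distances greater than `4`. -/
theorem eq_zero_of_flatNorm_le_one {x : Fin 3 → Space q}
    (hx : ∀ i j, i ≠ j → 4 < dist (x i) (x j)) {T : Current q 0}
    (hT : ∀ i, flatNorm 1 (T - pointMass (x i)) ≤ 1) : T = 0 := by
  have vanish : ∀ i j, i ≠ j → ∀ (g : Space q → ℝ) (hg : ContDiff ℝ ∞ g)
      (hgc : HasCompactSupport g), x i ∉ tsupport g → x j ∉ tsupport g →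
      T (zeroForm g hg hgc) = 0 := fun i j hij _ hg hgc hi hj =>
    apply_eq_zero_of_notMem_tsupport (hx i j hij) (hT i) (hT j) hg hgc hi hj
  let β : ∀ i, ContDiffBump (x i) := fun i => ⟨1, 2, one_pos, one_lt_two⟩
  have hβs : ∀ i, ContDiff ℝ ∞ (β i) := fun i => (β i).contDiff
  have hβ : ∀ i j, i ≠ j → x j ∉ tsupport (β i) := fun i j hij hj => by
    rw [(β i).tsupport_eq, Metric.mem_closedBall, dist_comm] at hj
    have h2 : dist (x i) (x j) ≤ 2 := hj
    linarith [hx i j hij]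
  have hβ1 : ∀ i, ∀ᶠ y in 𝓝 (x i), β i y = 1 := fun i => (β i).eventuallyEq_one
  ext η
  set g := η.toScalar
  have hg := η.contDiff_toScalar
  have hgc := η.hasCompactSupport_toScalar
  have hk : ∀ i, ContDiff ℝ ∞ ((β i : Space q → ℝ) * g) := fun i => (hβs i).mul hg
  have hkc : ∀ i, HasCompactSupport ((β i : Space q → ℝ) * g) := fun i => hgc.mul_left
  have hr : ContDiff ℝ ∞ ((1 - β 0 - β 1 : Space q → ℝ) * g) :=
    ((contDiff_const.sub (hβs 0)).sub (hβs 1)).mul hg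
  have hrc : HasCompactSupport ((1 - β 0 - β 1 : Space q → ℝ) * g) := hgc.mul_left
  -- Each piece avoids two of the three points: the first `x 1` and `x 2`, the second `x 0` and `x
  -- 2`, the remainder `x 0` and `x 1`.
  have e : η = zeroForm ((β 0 : Space q → ℝ) * g) (hk 0) (hkc 0) +
      zeroForm ((β 1 : Space q → ℝ) * g) (hk 1) (hkc 1) +
      zeroForm _ hr hrc := by
    conv_lhs => rw [← η.zeroForm_toScalar]
    ext y v
    change g y = β 0 y * g y + β 1 y * g y + (1 - β 0 y - β 1 y) * g y
    ring
  have out : ∀ i j, i ≠ j → x j ∉ tsupport ((β i : Space q → ℝ) * g) := fun i j hij h =>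
    hβ i j hij (tsupport_mul_subset_left h)
  have rest : ∀ i j, i ≠ j → (1 - β 0 - β 1 : Space q → ℝ) = 1 - β i - β j →
      x i ∉ tsupport ((1 - β 0 - β 1 : Space q → ℝ) * g) := fun i j hij hh => by
    rw [notMem_tsupport_iff_eventuallyEq, hh]
    filter_upwards [hβ1 i, notMem_tsupport_iff_eventuallyEq.1 (hβ j i hij.symm)] with y h₁ h₂
    simp [h₁, h₂]
  rw [e, map_add, map_add, vanish 1 2 (by decide) _ _ _ (out 0 1 (by decide)) (out 0 2 (by decide)),
    vanish 0 2 (by decide) _ _ _ (out 1 0 (by decide)) (out 1 2 (by decide)),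
    vanish 0 1 (by decide) _ _ _ (rest 0 1 (by decide) rfl)
      (rest 1 0 (by decide) (sub_right_comm _ _ _))]
  simp

/-! ### The minimal value and its uniqueness -/

theorem sum_flatNorm_zero_le (x : Fin 3 → Space q) :
    ∑ i, flatNorm 1 (0 - pointMass (x i)) ≤ 3 := by
  refine (Finset.sum_le_card_nsmul _ _ 1 fun i _ => ?_).trans (by simp)
  rw [zero_sub]
  exact (flatNorm_le_mass _ _).trans (mass_neg_pointMass_le _)

theorem three_le_sum_flatNorm {x : Fin 3 → Space q} (hx : ∀ i j, i ≠ j → 4 < dist (x i) (x j))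
    (T : Current q 0) : 3 ≤ ∑ i, flatNorm 1 (T - pointMass (x i)) := by
  have h₀ := flatNorm_pair_ge (hx 0 1 (by decide)) T
  have h₁ := flatNorm_pair_ge (hx 0 2 (by decide)) T
  have h₂ := flatNorm_pair_ge (hx 1 2 (by decide)) T
  rw [Fin.sum_univ_three]
  -- Each point lies in two of the three pairs, so the pair bounds add up to twice the sum.
  refine (ENNReal.mul_le_mul_iff_right (a := 2) (by simp) (by simp)).1 ?_
  calc (2 * 3 : ℝ≥0∞) = 2 + 2 + 2 := by norm_num
    _ ≤ _ := add_le_add (add_le_add h₀ h₁) h₂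
    _ = _ := by ring

theorem eq_zero_of_sum_flatNorm_le {x : Fin 3 → Space q}
    (hx : ∀ i j, i ≠ j → 4 < dist (x i) (x j)) {T : Current q 0}
    (hT : ∑ i, flatNorm 1 (T - pointMass (x i)) ≤ 3) : T = 0 := by
  have h₀ := flatNorm_pair_ge (hx 0 1 (by decide)) T
  have h₁ := flatNorm_pair_ge (hx 0 2 (by decide)) T
  have h₂ := flatNorm_pair_ge (hx 1 2 (by decide)) T
  rw [Fin.sum_univ_three] at hT
  have key : ∀ u v : ℝ≥0∞, 2 ≤ u → u + v ≤ 3 → v ≤ 1 := fun u v hu huv => by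
    refine (ENNReal.add_le_add_iff_left (a := 2) (by simp)).1 ?_
    exact (add_le_add_left hu v).trans (huv.trans (by norm_num))
  exact eq_zero_of_flatNorm_le_one hx fun
    | 0 => key _ _ h₂ (le_of_eq_of_le (by ring) hT)
    | 1 => key _ _ h₁ (le_of_eq_of_le (by ring) hT)
    | 2 => key _ _ h₀ hT

end Currents

end MedianShape

theorem mainTheorem9 (q : ℕ) (x : Fin 3 → MedianShape.Space q)
    (hx : ∀ i j, i ≠ j → 4 < dist (x i) (x j)) :
    (∀ T : MedianShape.Current q 0,
      MedianShape.IsMedian 1 (fun i => MedianShape.pointMass (x i)) T ↔ T = 0) ∧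
    (∀ (mu : ℝ≥0) (T : MedianShape.Current q 0),
      MedianShape.IsRegularizedMedian 1 mu (fun i => MedianShape.pointMass (x i)) T ↔ T = 0) := by
  open MedianShape in
  have h0 := sum_flatNorm_zero_le x
  refine ⟨fun T => ⟨fun h => ?_, ?_⟩, fun mu T => ⟨fun h => ?_, ?_⟩⟩
  · exact eq_zero_of_sum_flatNorm_le hx ((h.2 0 isIntegral_zero).trans h0)
  · rintro rfl
    exact ⟨isIntegral_zero, fun T' _ => h0.trans (three_le_sum_flatNorm hx T')⟩
  · have h' := h.2 0 isIntegral_zero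
    rw [objective, objective, mass_zero, mul_zero, add_zero] at h'
    exact eq_zero_of_sum_flatNorm_le hx (le_self_add.trans (h'.trans h0))
  · rintro rfl
    refine ⟨isIntegral_zero, fun T' _ => ?_⟩
    rw [objective, objective, mass_zero, mul_zero, add_zero]
    exact h0.trans ((three_le_sum_flatNorm hx T').trans le_self_add)
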